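/- Model (semi-synchronous model SSM with multiplicity detection). There are $n$ robots, points of the Euclidean plane, several of which may be at the same position. Each robot has its own coordinate system, centred at its current position, with arbitrary fixed axes (no common orientation or handedness) and an arbitrary unit of length. Its \emph{view} consists, in these coordinates, of the set of occupied positions and the set of those occupied by more than one robot. A \emph{protocol}, the same for all robots, maps the current view and the value of $\mathrm{Random}()$, uniform on $\{0,1\}$, to a destination in local coordinates; it has no memory, no identities and is not given $n$. It is a \emph{deterministic algorithm} if it does not use $\mathrm{Random}()$. At each time $t=0,1,2,\dots$ a scheduler activates a non-empty set of robots, which may depend on the whole past (and on randomness of the scheduler), such that almost surely every robot is activated infinitely often; given the past and the activated set, the values of $\mathrm{Random}()$ at time $t$ are independent and uniform. Each active robot $r$ simultaneously computes its destination from its view and moves to it if its distance is at most $\sigma_r$, and otherwise moves towards it by $\sigma_r$, where $\sigma_r>0$ is fixed and unknown to the robots; inactive robots do not move. A protocol is a \emph{self-stabilizing protocol for the Gathering Problem with probability $1$} for $n$ robots if, for every initial configuration (positions may coincide), all coordinate systems, all bounds $\sigma_r$ and every such scheduler, almost surely all robots are at one common point from some time on, and whenever all robots are at one point they remain there. Procedures.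 The Voronoi cell of an occupied position $p$ is the set of points strictly closer to $p$ than to every other occupied position. Procedure $SP$: if $\mathrm{Random}()=0$, move toward a chosen point of the Voronoi cell of the robot's own position, different from that position; otherwise do not move. Procedure $SSA_{GP}$, for a deterministic algorithm $A_{GP}$: if at least two positions hold more than one robot, execute $SP$; otherwise execute $A_{GP}$. Theorem. There is a protocol that, for every $n\ge 2$, is a self-stabilizing protocol for the Gathering Problem in SSM with multiplicity detection with probability $1$. It can be chosen such that (i) for $n=2$, an active robot moves toward the position of the other robot with probability $1/2$ and otherwise does not move; (ii) for $n\ge 3$, it is Procedure $SSA_{GP}$ with some choice of points in $SP$ and some deterministic algorithm $A_{GP}$ which, for every $n\ge3$, all coordinate systems and all bounds $\sigma_r$, gathers the robots at one point in finite time, where they remain, from every initial configuration with pairwise distinct positions and under every fair schedule. -/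

import Mathlib

namespace Robots

noncomputable section

open MeasureTheory

open scoped Classical

/-- The Euclidean plane. -/
abbrev Plane := EuclideanSpace ℝ (Fin 2)

/-- A configuration of `n` robots: the position of each of them (positions may coincide). -/
abbrev Config (n : ℕ) := Fin n → Plane

/-- A robot's own coordinate system: its axes (orientation and handedness are arbitrary) and the
length of its unit. The origin is the current position of the robot. -/
structure Frame where
  axes : Plane ≃ₗᵢ[ℝ] Plane
  unit : ℝ
  unit_pos : 0 < unit

/-- The coordinates of the point `q` for a robot located at `p`. -/
def Frame.toLocal (F : Frame) (p q : Plane) : Plane := F.unit⁻¹ • F.axes (q - p)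

/-- The point of the plane with coordinates `x` for a robot located at `p`. -/
def Frame.toGlobal (F : Frame) (p x : Plane) : Plane := p + F.unit • F.axes.symm x

/-- What a robot with multiplicity detection sees, in its own coordinates (so that the robot itself
is at `0`): the occupied positions, and those among them that hold more than one robot. -/
structure View where
  occupied : Finset Plane
  multiple : Finset Plane

/-- The view of the robot `i` in the configuration `p`. -/
def view {n : ℕ} (F : Frame) (p : Config n) (i : Fin n) : View where
  occupied := Finset.univ.image fun j => F.toLocal (p i) (p j)
  multiple := (Finset.univ.image fun j => F.toLocal (p i) (p j)).filter fun x =>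
    1 < (Finset.univ.filter fun j => F.toLocal (p i) (p j) = x).card

/-- A deterministic algorithm (uniform, anonymous, oblivious): the destination, in local
coordinates, as a function of the current view only. -/
abbrev DetAlgorithm := View → Plane

/-- A randomized protocol (uniform, anonymous, oblivious): the destination, in local coordinates,
as a function of the current view and of the value of `Random()`, uniform on `{0, 1}`.
It is not told the number of robots. -/
abbrev Protocol := View → Fin 2 → Plane

/-- A deterministic algorithm as a protocol that ignores its coin. -/
def DetAlgorithm.toProtocol (A : DetAlgorithm) : Protocol := fun v _ => A v

/-- A move from `p` towards `q` of length at most `s`. -/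
def moveToward (s : ℝ) (p q : Plane) : Plane :=
  if dist p q ≤ s then q else p + (s / dist p q) • (q - p)

/-- One computation step: the active robots (the set `act`) look, compute and move
simultaneously, the others stay where they are. -/
def step {n : ℕ} (P : Protocol) (F : Fin n → Frame) (σ : Fin n → ℝ)
    (act : Finset (Fin n)) (coin : Fin n → Fin 2) (p : Config n) : Config n := fun i =>
  if i ∈ act then
    moveToward (σ i) (p i) ((F i).toGlobal (p i) (P (view (F i) p i) (coin i)))
  else p i

/-- The configuration at time `t`, from the initial configuration `p₀`, when the scheduler
activates `act s` and the robots draw `coin s` at time `s`. -/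
def run {n : ℕ} (P : Protocol) (F : Fin n → Frame) (σ : Fin n → ℝ) (p₀ : Config n)
    (act : ℕ → Finset (Fin n)) (coin : ℕ → Fin n → Fin 2) : ℕ → Config n
  | 0 => p₀
  | t + 1 => step P F σ (act t) (coin t) (run P F σ p₀ act coin t)

/-- All the robots are at the point `x`. -/
def GatheredAt {n : ℕ} (p : Config n) (x : Plane) : Prop := ∀ i, p i = x

/-- Every robot is activated infinitely often. -/
def IsFair {n : ℕ} (act : ℕ → Finset (Fin n)) : Prop := ∀ i, ∀ t, ∃ s, t ≤ s ∧ i ∈ act s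

/-- A scheduler together with the coins of the robots, on a probability space. The activated sets
are non-empty, almost surely fair, and may depend on everything that happened before (and on
randomness of the scheduler); the coins drawn at time `t` are independent and uniform given that
past, which includes the choice of the set activated at time `t`. -/
structure RandomSchedule {Ω : Type} [m : MeasurableSpace Ω] (μ : Measure Ω) (n : ℕ) where
  past : Filtration ℕ m
  act : ℕ → Ω → Finset (Fin n)
  coin : ℕ → Ω → Fin n → Fin 2
  act_measurable : ∀ t (s : Finset (Fin n)), MeasurableSet[past t] {ω | act t ω = s}
  coin_measurable : ∀ t (c : Fin n → Fin 2), MeasurableSet[past (t + 1)] {ω | coin t ω = c}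
  coin_uniform : ∀ t (c : Fin n → Fin 2) (E : Set Ω), MeasurableSet[past t] E →
    μ ({ω | coin t ω = c} ∩ E) = (2⁻¹ : ENNReal) ^ n * μ E
  act_nonempty : ∀ t ω, (act t ω).Nonempty
  act_fair : ∀ᵐ ω ∂μ, IsFair fun t => act t ω

/-- `P` is a self-stabilizing protocol for gathering `n` robots with probability 1: from every
initial configuration, whatever the coordinate systems, the travel bounds and the fair scheduler,
almost surely the robots are all at one same point from some time on (convergence), and once
gathered at a point they stay there (closure). -/
def SelfStabilizingGathering (n : ℕ) (P : Protocol) : Prop :=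
  ∀ (F : Fin n → Frame) (σ : Fin n → ℝ), (∀ i, 0 < σ i) → ∀ p₀ : Config n,
  ∀ (Ω : Type) [MeasurableSpace Ω] (μ : Measure Ω) [IsProbabilityMeasure μ]
    (S : RandomSchedule μ n), ∀ᵐ ω ∂μ,
      (∃ (T : ℕ) (x : Plane), ∀ t, T ≤ t →
        GatheredAt (run P F σ p₀ (fun s => S.act s ω) (fun s => S.coin s ω) t) x) ∧
      (∀ (t : ℕ) (x : Plane),
        GatheredAt (run P F σ p₀ (fun s => S.act s ω) (fun s => S.coin s ω) t) x →
        GatheredAt (run P F σ p₀ (fun s => S.act s ω) (fun s => S.coin s ω) (t + 1)) x)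

/-- `A` deterministically gathers `n` robots from every initial configuration without two robots at
the same position, under every fair scheduler. -/
def DetGatheringFromDistinct (n : ℕ) (A : DetAlgorithm) : Prop :=
  ∀ (F : Fin n → Frame) (σ : Fin n → ℝ), (∀ i, 0 < σ i) →
  ∀ p₀ : Config n, Function.Injective p₀ →
  ∀ (act : ℕ → Finset (Fin n)) (coin : ℕ → Fin n → Fin 2),
    (∀ t, (act t).Nonempty) → IsFair act →
    ∃ (T : ℕ) (x : Plane), ∀ t, T ≤ t → GatheredAt (run A.toProtocol F σ p₀ act coin t) x

/-- The (open) Voronoi cell of `p` in the diagram of the set `S`. -/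
def voronoiCell (S : Finset Plane) (p : Plane) : Set Plane :=
  {q | ∀ p' ∈ S, p' ≠ p → dist q p < dist q p'}

/-- A choice of a position in the robot's own Voronoi cell, different from its current one. -/
def IsCellChoice (c : View → Plane) : Prop :=
  ∀ v, c v ∈ voronoiCell v.occupied 0 ∧ c v ≠ 0

/-- Procedure `SP` (scattering), with the choice `c` of the position in the Voronoi cell. -/
def procSP (c : View → Plane) : Protocol := fun v r => if r = 0 then c v else 0

/-- Procedure `SSA_GP`: scatter if at least two positions hold more than one robot, and execute
the deterministic algorithm `A` otherwise. -/
def procSSAGP (c : View → Plane) (A : DetAlgorithm) : Protocol := fun v r =>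
  if 2 ≤ v.multiple.card then procSP c v r else A v

/-- The position of the other robot, in a view of two robots (`0` if they are together). -/
def otherPosition (v : View) : Plane :=
  if h : ∃ x ∈ v.occupied, x ≠ 0 then h.choose else 0

/-- The routine for two robots: go to the other robot's position with probability `1/2`. -/
def procPair : Protocol := fun v r => if r = 0 then otherPosition v else 0

/-- With `n` robots, the protocols `P` and `Q` behave in the same way. -/
def SameBehaviour (n : ℕ) (P Q : Protocol) : Prop :=
  ∀ (F : Frame) (p : Config n) (i : Fin n) (r : Fin 2), P (view F p i) r = Q (view F p i) r

end

end Robots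

namespace Robots

noncomputable section

open MeasureTheory

open scoped Classical

/-! ### Local coordinates and views -/

/-! Take $n\ge 3$ and suppose at most one position is multiple. All robots agree on a target if
there is a pole: the multiple position, or, when all positions are distinct, a strict minimizer of
the sum of distances. Only robots nearest to it, among those not yet there, approach it. This rule
creates no coincidence away from the target, and by the triangle inequality a strict median stays
one when robots move straight towards it. Hence a pole is invariant (`IsPole.step`), and an integer
count of remaining moves forces arrival (`IsPole.eventually_gatheredAt`).

If distinct robots have no strict median, two minimizers exist. Equality in the triangle inequality
at their midpoint puts all robots on one line, half on each side of a gap (`exists_four_on_line`).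
The end robots step off perpendicularly; at least two inner robots stay and pin the line, so after
the first move the robots are distinct and not collinear, and a strict median exists
(`sidestep_step`).

With several multiple positions, scattering inside Voronoi cells never merges distinct positions
(`IsCellChoice.eq_of_step_eq`), so the number of coincident pairs never grows. It drops whenever
exactly the right robot draws 0, a pattern of conditional probability $2^{-n}$. Lévy's conditional
Borel–Cantelli lemma makes this happen infinitely often as long as scattering goes on
(`RandomSchedule.ae_frequently_coin_eq`), so scattering ends.

For two robots, the distance never grows and drops by a fixed amount, or to 0, when exactly one
active robot moves. The two routines combine without knowing $n$: two occupied positions, both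
simple, occur only for $n=2$. -/

theorem Frame.toGlobal_toLocal (F : Frame) (p q : Plane) : F.toGlobal p (F.toLocal p q) = q := by
  simp [Frame.toGlobal, Frame.toLocal, smul_smul, F.unit_pos.ne']

theorem Frame.toLocal_toGlobal (F : Frame) (p x : Plane) : F.toLocal p (F.toGlobal p x) = x := by
  simp [Frame.toGlobal, Frame.toLocal, smul_smul, F.unit_pos.ne']

theorem Frame.toLocal_self (F : Frame) (p : Plane) : F.toLocal p p = 0 := by
  simp [Frame.toLocal]

theorem Frame.toGlobal_zero (F : Frame) (p : Plane) : F.toGlobal p 0 = p := by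
  simp [Frame.toGlobal]

theorem Frame.toLocal_inj (F : Frame) {p q q' : Plane} :
    F.toLocal p q = F.toLocal p q' ↔ q = q' :=
  ⟨fun h => by rw [← F.toGlobal_toLocal p q, h, F.toGlobal_toLocal], fun h => h ▸ rfl⟩

theorem Frame.toLocal_eq_zero (F : Frame) {p q : Plane} : F.toLocal p q = 0 ↔ q = p := by
  rw [← F.toLocal_self p, F.toLocal_inj]

theorem Frame.dist_toLocal (F : Frame) (p q q' : Plane) :
    dist (F.toLocal p q) (F.toLocal p q') = F.unit⁻¹ * dist q q' := by
  rw [Frame.toLocal, Frame.toLocal, dist_smul₀, F.axes.dist_map, dist_sub_right,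
    Real.norm_of_nonneg (inv_nonneg.2 F.unit_pos.le)]

theorem Frame.inner_toLocal (F : Frame) (p q q' : Plane) :
    inner ℝ (F.toLocal p q) (F.toLocal p q') =
      F.unit⁻¹ * (F.unit⁻¹ * inner ℝ (q - p) (q' - p)) := by
  rw [Frame.toLocal, Frame.toLocal, real_inner_smul_left, real_inner_smul_right,
    F.axes.inner_map_map]

section View

variable {n : ℕ} (F : Frame) (p : Config n) (i : Fin n)

theorem mem_occupied {x : Plane} :
    x ∈ (view F p i).occupied ↔ ∃ j, F.toLocal (p i) (p j) = x := by
  simp [view]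

theorem toLocal_mem_multiple {y : Plane} :
    F.toLocal (p i) y ∈ (view F p i).multiple ↔ ∃ j k, j ≠ k ∧ p j = y ∧ p k = y := by
  simp only [view, Finset.mem_filter, Finset.mem_image, Finset.mem_univ, true_and, F.toLocal_inj,
    Finset.one_lt_card]
  constructor
  · rintro ⟨-, j, hj, k, hk, hjk⟩
    exact ⟨j, k, hjk, hj, hk⟩
  · rintro ⟨j, k, hjk, hj, hk⟩
    exact ⟨⟨j, hj⟩, j, hj, k, hk, hjk⟩

theorem mem_multiple {x : Plane} : x ∈ (view F p i).multiple ↔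
    ∃ j k, j ≠ k ∧ p j = F.toGlobal (p i) x ∧ p k = F.toGlobal (p i) x := by
  rw [← toLocal_mem_multiple F p i, F.toLocal_toGlobal]

theorem multiple_eq_empty : (view F p i).multiple = ∅ ↔ Function.Injective p := by
  rw [Finset.eq_empty_iff_forall_notMem]
  constructor
  · intro h j k hjk
    by_contra hne
    exact h _ ((toLocal_mem_multiple F p i).2 ⟨j, k, hne, hjk, rfl⟩)
  · intro h x hx
    obtain ⟨j, k, hne, hj, hk⟩ := (mem_multiple F p i).1 hx
    exact hne (h (hj.trans hk.symm))

theorem sum_occupied (hp : Function.Injective p) (f : Plane → ℝ) :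
    ∑ x ∈ (view F p i).occupied, f x = ∑ j, f (F.toLocal (p i) (p j)) := by
  rw [view, Finset.sum_image]
  exact fun a _ b _ h => hp (F.toLocal_inj.1 h)

/-- At least two positions hold more than one robot. -/
def ManyMultiple (p : Config n) : Prop :=
  ∃ i j k l, i ≠ j ∧ k ≠ l ∧ p i = p j ∧ p k = p l ∧ p i ≠ p k

theorem two_le_card_multiple : 2 ≤ (view F p i).multiple.card ↔ ManyMultiple p := by
  rw [← Nat.lt_iff_add_one_le, Finset.one_lt_card]
  constructor
  · rintro ⟨x, hx, y, hy, hxy⟩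
    obtain ⟨j, k, hne, hj, hk⟩ := (mem_multiple F p i).1 hx
    obtain ⟨j', k', hne', hj', hk'⟩ := (mem_multiple F p i).1 hy
    refine ⟨j, k, j', k', hne, hne', hj.trans hk.symm, hj'.trans hk'.symm, fun h => hxy ?_⟩
    rw [← F.toLocal_toGlobal (p i) x, ← F.toLocal_toGlobal (p i) y, ← hj, ← hj', h]
  · rintro ⟨j, k, j', k', hne, hne', h, h', hd⟩
    exact ⟨F.toLocal (p i) (p j), (toLocal_mem_multiple F p i).2 ⟨j, k, hne, rfl, h.symm⟩,
      F.toLocal (p i) (p j'), (toLocal_mem_multiple F p i).2 ⟨j', k', hne', rfl, h'.symm⟩,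
      fun e => hd (F.toLocal_inj.1 e)⟩

end View

/-! ### Moves -/

theorem moveToward_self (s : ℝ) (hs : 0 ≤ s) (p : Plane) : moveToward s p p = p := by
  simp [moveToward, hs]

theorem exists_moveToward_eq {s : ℝ} (hs : 0 < s) (p q : Plane) :
    ∃ a : ℝ, 0 < a ∧ a ≤ 1 ∧ moveToward s p q = p + a • (q - p) := by
  unfold moveToward
  split_ifs with h
  · exact ⟨1, one_pos, le_rfl, by simp⟩
  · push Not at h
    have hd : 0 < dist p q := hs.trans h
    exact ⟨s / dist p q, by positivity, (div_le_one hd).2 h.le, rfl⟩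

theorem dist_moveToward {s : ℝ} (hs : 0 < s) (p q : Plane) :
    dist (moveToward s p q) q = max (dist p q - s) 0 := by
  unfold moveToward
  split_ifs with h
  · rw [dist_self, max_eq_right (by linarith)]
  · push Not at h
    have hd : 0 < dist p q := hs.trans h
    have e : p + (s / dist p q) • (q - p) - q = (1 - s / dist p q) • (p - q) := by module
    rw [dist_eq_norm, e, norm_smul, ← dist_eq_norm p q, max_eq_left (by linarith),
      Real.norm_of_nonneg (by rw [sub_nonneg, div_le_one hd]; exact h.le)]
    field_simp

theorem dist_moveToward_add {s : ℝ} (hs : 0 < s) (p q : Plane) :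
    dist p (moveToward s p q) + dist (moveToward s p q) q = dist p q := by
  obtain ⟨a, h0, h1, e⟩ := exists_moveToward_eq hs p q
  have e1 : p - (p + a • (q - p)) = a • (p - q) := by module
  have e2 : p + a • (q - p) - q = (1 - a) • (p - q) := by module
  rw [e, dist_eq_norm, dist_eq_norm, dist_eq_norm, e1, e2, norm_smul, norm_smul,
    Real.norm_of_nonneg h0.le, Real.norm_of_nonneg (by linarith)]
  ring

/-- Rounding up turns real distances into natural-number potentials: a move either lowers the
quotient by 1 or brings it to 0. -/
theorem ceil_max_sub_lt {s d : ℝ} (hs : 0 < s) (hd : 0 < d) :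
    ⌈max (d - s) 0 / s⌉₊ < ⌈d / s⌉₊ := by
  have h1 : 1 ≤ ⌈d / s⌉₊ := Nat.one_le_ceil_iff.2 (by positivity)
  suffices ⌈max (d - s) 0 / s⌉₊ ≤ ⌈d / s⌉₊ - 1 by omega
  refine Nat.ceil_le.2 ?_
  rw [Nat.cast_sub h1, div_le_iff₀ hs]
  have h2 := Nat.le_ceil (d / s)
  have h3 : (1 : ℝ) ≤ ⌈d / s⌉₊ := by exact_mod_cast h1
  rw [div_le_iff₀ hs] at h2
  refine max_le (by push_cast; linarith) ?_
  exact mul_nonneg (by push_cast; linarith) hs.le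

/-! ### The deterministic algorithm -/

/-- The common destination that a view determines: the multiple position if there is exactly one,
and the strict minimizer of the sum of the distances if all positions are simple. -/
def IsTarget (v : View) (w : Plane) : Prop :=
  v.multiple = {w} ∨ v.multiple = ∅ ∧
    ∀ y, y ≠ w → ∑ x ∈ v.occupied, dist x w < ∑ x ∈ v.occupied, dist x y

/-- Only the robots closest to the target, among those not yet there, move to it. -/
def approach (v : View) (w : Plane) : Plane :=
  if ∀ x ∈ v.occupied, x ≠ w → dist 0 w ≤ dist x w then w else 0

/-- The robots at the ends of a line of robots leave this line perpendicularly. -/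
def sidestep (v : View) : Plane :=
  if h : (∀ x ∈ v.occupied, ∀ y ∈ v.occupied, (0 : ℝ) ≤ inner ℝ x y) ∧
      ∃ u : Plane, u ≠ 0 ∧ ∀ x ∈ v.occupied, inner ℝ u x = (0 : ℝ)
  then h.2.choose else 0

/-- The deterministic algorithm: approach the target if there is one, leave the common line
otherwise. -/
def gatherAlg : DetAlgorithm := fun v =>
  if h : ∃ w, IsTarget v w then approach v h.choose else sidestep v

/-- This makes the arbitrary choice in `gatherAlg` harmless: whatever element is chosen is the
target. -/
theorem IsTarget.unique {v : View} {w w' : Plane} (h : IsTarget v w) (h' : IsTarget v w') :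
    w = w' := by
  rcases h with h | ⟨h, hm⟩ <;> rcases h' with h' | ⟨h', hm'⟩
  · exact Finset.singleton_injective (h.symm.trans h')
  · simp [h] at h'
  · simp [h] at h'
  · by_contra hne
    exact lt_asymm (hm w' (Ne.symm hne)) (hm' w hne)

theorem IsTarget.gatherAlg_eq {v : View} {w : Plane} (h : IsTarget v w) :
    gatherAlg v = approach v w := by
  have hex : ∃ w, IsTarget v w := ⟨w, h⟩
  rw [gatherAlg, dif_pos hex, hex.choose_spec.unique h]

/-! ### Poles: targets on which all robots agree -/

section Pole

variable {n : ℕ}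

/-- `w` minimizes strictly the sum of the distances to the robots. -/
def IsStrictMedian (p : Config n) (w : Plane) : Prop :=
  ∀ y, y ≠ w → ∑ i, dist (p i) w < ∑ i, dist (p i) y

/-- No two robots are together except possibly at `w`, which holds several robots or is the strict
median. -/
structure IsPole (p : Config n) (w : Plane) : Prop where
  eq_of_ne : ∀ i j, i ≠ j → p i = p j → p i = w
  multiple_or_median : (∃ i j, i ≠ j ∧ p i = w ∧ p j = w) ∨ IsStrictMedian p w

/-- A change of frame scales all distances by one factor. Injectivity matters because a view lists
positions, not robots, so only then is the sum over positions the sum over robots. -/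
theorem isTarget_view_of_injective (F : Frame) {p : Config n} (hp : Function.Injective p)
    (i : Fin n) (w : Plane) :
    IsTarget (view F p i) (F.toLocal (p i) w) ↔ IsStrictMedian p w := by
  have he := (multiple_eq_empty F p i).2 hp
  have hu : 0 < F.unit⁻¹ := inv_pos.2 F.unit_pos
  simp only [IsTarget, he, sum_occupied F p i hp, true_and, IsStrictMedian]
  rw [or_iff_right (Finset.singleton_ne_empty _).symm]
  constructor
  · intro h y hy
    have := h (F.toLocal (p i) y) (fun e => hy (F.toLocal_inj.1 e))
    simp only [F.dist_toLocal, ← Finset.mul_sum] at this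
    exact lt_of_mul_lt_mul_left this hu.le
  · intro h y hy
    obtain ⟨y, rfl⟩ : ∃ y', y = F.toLocal (p i) y' := ⟨_, (F.toLocal_toGlobal (p i) y).symm⟩
    have := h y (fun e => hy (e ▸ rfl))
    simp only [F.dist_toLocal, ← Finset.mul_sum]
    exact mul_lt_mul_of_pos_left this hu

theorem IsPole.isTarget_view {p : Config n} {w : Plane} (h : IsPole p w) (F : Frame) (i : Fin n) :
    IsTarget (view F p i) (F.toLocal (p i) w) := by
  by_cases hp : Function.Injective p
  · rw [isTarget_view_of_injective F hp]
    refine h.multiple_or_median.resolve_left ?_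
    rintro ⟨a, b, hab, ha, hb⟩
    exact hab (hp (ha.trans hb.symm))
  · left
    ext x
    rw [Finset.mem_singleton, mem_multiple]
    constructor
    · rintro ⟨j, k, hne, hj, hk⟩
      rw [← h.eq_of_ne j k hne (hj.trans hk.symm), hj, F.toLocal_toGlobal]
    · rintro rfl
      simp only [Function.Injective, not_forall] at hp
      obtain ⟨a, b, hab, hne⟩ := hp
      have := h.eq_of_ne a b hne hab
      exact ⟨a, b, hne, by rw [F.toGlobal_toLocal, this], by rw [F.toGlobal_toLocal, ← hab, this]⟩

/-- The robot `i` is closest to `w` among the robots that are not at `w`. -/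
def IsClosest (p : Config n) (w : Plane) (i : Fin n) : Prop :=
  ∀ j, p j ≠ w → dist (p i) w ≤ dist (p j) w

theorem IsPole.toGlobal_gatherAlg {p : Config n} {w : Plane} (h : IsPole p w) (F : Frame)
    (i : Fin n) :
    F.toGlobal (p i) (gatherAlg (view F p i)) = if IsClosest p w i then w else p i := by
  rw [(h.isTarget_view F i).gatherAlg_eq, approach]
  have hiff : (∀ x ∈ (view F p i).occupied, x ≠ F.toLocal (p i) w →
      dist 0 (F.toLocal (p i) w) ≤ dist x (F.toLocal (p i) w)) ↔ IsClosest p w i := by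
    simp only [mem_occupied, forall_exists_index, forall_apply_eq_imp_iff, IsClosest, ne_eq,
      F.toLocal_inj]
    refine forall_congr' fun j => imp_congr_right fun _ => ?_
    rw [← F.toLocal_self (p i), F.dist_toLocal, F.dist_toLocal,
      mul_le_mul_iff_right₀ (inv_pos.2 F.unit_pos)]
  simp only [hiff]
  split_ifs
  · rw [F.toGlobal_toLocal]
  · rw [F.toGlobal_zero]

end Pole

/-! ### Progress under a fair schedule -/

theorem not_forall_exists_lt_of_antitone {Φ : ℕ → ℕ} (h : Antitone Φ) :
    ¬ ∀ t, ∃ s, t ≤ s ∧ Φ (s + 1) < Φ s := by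
  intro hlt
  obtain ⟨t, ht⟩ : ∃ t, ∀ s, Φ t ≤ Φ s := by
    obtain ⟨-, ⟨t, rfl⟩, ht⟩ := WellFounded.has_min (wellFounded_lt (α := ℕ)) (Set.range Φ)
      ⟨_, 0, rfl⟩
    exact ⟨t, fun s => not_lt.1 (ht _ ⟨s, rfl⟩)⟩
  obtain ⟨s, hs, h1⟩ := hlt t
  exact absurd (h1.trans_le (h hs)) (not_lt.2 (ht _))

section

variable {n : ℕ} {F : Fin n → Frame} {σ : Fin n → ℝ} {act : Finset (Fin n)}
  {coin : Fin n → Fin 2} {p : Config n} {w : Plane}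

/-- Until the first change the configuration is frozen, so fairness eventually activates `i` in the
very configuration of time `t`. -/
theorem exists_first_move {act : ℕ → Finset (Fin n)} (hfair : IsFair act) {q : ℕ → Config n}
    (t : ℕ) (i : Fin n) (h : ∀ s, i ∈ act s → q s = q t → q (s + 1) ≠ q s) :
    ∃ s, t ≤ s ∧ q s = q t ∧ q (s + 1) ≠ q s := by
  by_contra! hc
  have hconst : ∀ s, t ≤ s → q s = q t := fun s hs => by
    induction s, hs using Nat.le_induction with
    | base => rfl
    | succ s hs ih => rw [hc s hs ih, ih]
  obtain ⟨s, hs, hi⟩ := hfair i t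
  exact h s hi (hconst s hs) (hc s hs (hconst s hs))

/-! ### Approaching the target -/

theorem IsPole.step_eq (h : IsPole p w) (hσ : ∀ i, 0 < σ i) (i : Fin n) :
    step gatherAlg.toProtocol F σ act coin p i =
      if i ∈ act ∧ IsClosest p w i then moveToward (σ i) (p i) w else p i := by
  simp only [step, DetAlgorithm.toProtocol, h.toGlobal_gatherAlg]
  by_cases hi : i ∈ act <;> by_cases hc : IsClosest p w i <;>
    simp [hi, hc, moveToward_self _ (hσ i).le]

theorem IsPole.step_eq_or (h : IsPole p w) (hσ : ∀ i, 0 < σ i) (i : Fin n) :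
    step gatherAlg.toProtocol F σ act coin p i = p i ∨
      IsClosest p w i ∧ step gatherAlg.toProtocol F σ act coin p i = moveToward (σ i) (p i) w := by
  rw [h.step_eq hσ]
  split_ifs with hi
  · exact Or.inr ⟨hi.2, rfl⟩
  · exact Or.inl rfl

theorem IsPole.dist_step_add (h : IsPole p w) (hσ : ∀ i, 0 < σ i) (i : Fin n) :
    dist (p i) (step gatherAlg.toProtocol F σ act coin p i) +
      dist (step gatherAlg.toProtocol F σ act coin p i) w = dist (p i) w := by
  rcases h.step_eq_or (F := F) (act := act) (coin := coin) hσ i with e | ⟨-, e⟩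
  · rw [e, dist_self, zero_add]
  · rw [e, dist_moveToward_add (hσ i)]

theorem IsPole.step_eq_of_eq (h : IsPole p w) (hσ : ∀ i, 0 < σ i) {i : Fin n} (hi : p i = w) :
    step gatherAlg.toProtocol F σ act coin p i = w := by
  have := h.dist_step_add (F := F) (act := act) (coin := coin) hσ i
  rw [hi, dist_self] at this
  have h0 := dist_nonneg (x := w) (y := step gatherAlg.toProtocol F σ act coin p i)
  exact dist_le_zero.1 (by linarith)

theorem dist_moveToward_lt {s : ℝ} (hs : 0 < s) {x y : Plane} (h : x ≠ y) :
    dist (moveToward s x y) y < dist x y := by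
  rw [dist_moveToward hs]
  exact max_lt (by linarith) (dist_pos.2 h)

/-- Both moves are contractions towards `w`. Equal starting distances and a common image other than
`w` force equal nonzero ratios, which can be cancelled. -/
theorem eq_of_moveToward_eq {s s' : ℝ} (hs : 0 < s) (hs' : 0 < s') {x y : Plane}
    (hd : dist x w = dist y w) (h : moveToward s x w = moveToward s' y w)
    (hne : moveToward s x w ≠ w) : x = y := by
  obtain ⟨a, -, ha, e⟩ := exists_moveToward_eq hs x w
  obtain ⟨b, -, hb, e'⟩ := exists_moveToward_eq hs' y w
  have ea : moveToward s x w - w = (1 - a) • (x - w) := by rw [e]; module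
  have eb : moveToward s x w - w = (1 - b) • (y - w) := by rw [h, e']; module
  have hnorm := congrArg norm (ea.symm.trans eb)
  rw [norm_smul, norm_smul, ← dist_eq_norm x, ← dist_eq_norm y, ← hd,
    Real.norm_of_nonneg (by linarith), Real.norm_of_nonneg (by linarith)] at hnorm
  have hxw : 0 < dist x w := by
    refine dist_pos.2 fun hx => hne (sub_eq_zero.1 ?_)
    rw [ea, hx, sub_self, smul_zero]
  have hab : 1 - a = 1 - b := mul_right_cancel₀ hxw.ne' hnorm
  have hb0 : 1 - b ≠ 0 := fun h0 => hne (sub_eq_zero.1 (by rw [eb, h0, zero_smul]))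
  rw [ea, hab] at eb
  exact sub_left_injective (smul_right_injective _ hb0 eb)

/-- This is where the nearest-first rule is needed: a mover ends strictly closer to `w` than any
robot that stayed away from `w`, and two movers start at equal distance. -/
theorem IsPole.eq_of_step_eq (h : IsPole p w) (hσ : ∀ i, 0 < σ i) {i j : Fin n}
    (hij : step gatherAlg.toProtocol F σ act coin p i =
      step gatherAlg.toProtocol F σ act coin p j)
    (hw : step gatherAlg.toProtocol F σ act coin p i ≠ w) : p i = p j := by
  have hi : p i ≠ w := fun e => hw (h.step_eq_of_eq hσ e)
  have hj : p j ≠ w := fun e => hw (hij.trans (h.step_eq_of_eq hσ e))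
  rcases h.step_eq_or (F := F) (act := act) (coin := coin) hσ i with ei | ⟨ci, ei⟩ <;>
    rcases h.step_eq_or (F := F) (act := act) (coin := coin) hσ j with ej | ⟨cj, ej⟩
  · rw [← ei, ← ej, hij]
  · have h1 := dist_moveToward_lt (hσ j) hj
    rw [← ej, ← hij, ei] at h1
    exact absurd (cj i hi) (not_le.2 h1)
  · have h1 := dist_moveToward_lt (hσ i) hi
    rw [← ei, hij, ej] at h1
    exact absurd (ci j hj) (not_le.2 h1)
  · rw [ei] at hw hij
    rw [ej] at hij
    exact eq_of_moveToward_eq (hσ i) (hσ j) (le_antisymm (ci j hj) (cj i hi)) hij hw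

theorem IsPole.step (h : IsPole p w) (hσ : ∀ i, 0 < σ i) :
    IsPole (step gatherAlg.toProtocol F σ act coin p) w := by
  refine ⟨fun i j hne hij => ?_, ?_⟩
  · by_contra hw
    have e := h.eq_of_step_eq hσ hij hw
    exact hw (h.step_eq_of_eq hσ (h.eq_of_ne i j hne e))
  · refine h.multiple_or_median.imp ?_ ?_
    · rintro ⟨i, j, hne, hi, hj⟩
      exact ⟨i, j, hne, h.step_eq_of_eq hσ hi, h.step_eq_of_eq hσ hj⟩
    · intro hm y hy
      have h1 := hm y hy
      have h2 : ∑ i, dist (p i) w =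
          ∑ i, dist (p i) (Robots.step gatherAlg.toProtocol F σ act coin p i) +
            ∑ i, dist (Robots.step gatherAlg.toProtocol F σ act coin p i) w := by
        rw [← Finset.sum_add_distrib]
        exact Finset.sum_congr rfl fun i _ => (h.dist_step_add hσ i).symm
      have h3 : ∑ i, dist (p i) y ≤
          ∑ i, dist (p i) (Robots.step gatherAlg.toProtocol F σ act coin p i) +
            ∑ i, dist (Robots.step gatherAlg.toProtocol F σ act coin p i) y := by
        rw [← Finset.sum_add_distrib]
        exact Finset.sum_le_sum fun i _ => dist_triangle _ _ _
      linarith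

/-- The total number of moves needed to reach `w`. -/
def workload (σ : Fin n → ℝ) (w : Plane) (p : Config n) : ℕ := ∑ i, ⌈dist (p i) w / σ i⌉₊

theorem IsPole.workload_step_le (h : IsPole p w) (hσ : ∀ i, 0 < σ i) :
    workload σ w (Robots.step gatherAlg.toProtocol F σ act coin p) ≤ workload σ w p := by
  refine Finset.sum_le_sum fun i _ => Nat.ceil_mono (div_le_div_of_nonneg_right ?_ (hσ i).le)
  have := h.dist_step_add (F := F) (act := act) (coin := coin) hσ i
  linarith [dist_nonneg (x := p i) (y := Robots.step gatherAlg.toProtocol F σ act coin p i)]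

theorem IsPole.workload_step_lt (h : IsPole p w) (hσ : ∀ i, 0 < σ i)
    (hne : Robots.step gatherAlg.toProtocol F σ act coin p ≠ p) :
    workload σ w (Robots.step gatherAlg.toProtocol F σ act coin p) < workload σ w p := by
  obtain ⟨i, hi⟩ := Function.ne_iff.1 hne
  refine Finset.sum_lt_sum (fun j _ => Nat.ceil_mono (div_le_div_of_nonneg_right ?_ (hσ j).le))
    ⟨i, Finset.mem_univ i, ?_⟩
  · have := h.dist_step_add (F := F) (act := act) (coin := coin) hσ j
    linarith [dist_nonneg (x := p j) (y := Robots.step gatherAlg.toProtocol F σ act coin p j)]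
  · have hw : p i ≠ w := fun e => hi ((h.step_eq_of_eq hσ e).trans e.symm)
    rcases h.step_eq_or (F := F) (act := act) (coin := coin) hσ i with ei | ⟨-, ei⟩
    · exact absurd ei hi
    · rw [ei, dist_moveToward (hσ i)]
      exact ceil_max_sub_lt (hσ i) (dist_pos.2 hw)

theorem exists_isClosest (h : ¬ GatheredAt p w) : ∃ i, p i ≠ w ∧ IsClosest p w i := by
  simp only [GatheredAt, not_forall] at h
  obtain ⟨k, hk⟩ := h
  obtain ⟨i, hi, hmin⟩ := (Finset.univ.filter fun j => p j ≠ w).exists_min_image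
    (fun j => dist (p j) w) ⟨k, by simp [hk]⟩
  exact ⟨i, by simpa using hi, fun j hj => hmin j (by simp [hj])⟩

/-- The run need only obey the algorithm while `w` is a pole, so the result serves both the
algorithm alone and the randomized protocol. -/
theorem IsPole.eventually_gatheredAt (hσ : ∀ i, 0 < σ i) {act : ℕ → Finset (Fin n)}
    {coin : ℕ → Fin n → Fin 2} (hfair : IsFair act) {q : ℕ → Config n}
    (hq : ∀ t, IsPole (q t) w →
      q (t + 1) = Robots.step gatherAlg.toProtocol F σ (act t) (coin t) (q t))
    {T : ℕ} (h0 : IsPole (q T) w) : ∃ T', ∀ t, T' ≤ t → GatheredAt (q t) w := by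
  have hp : ∀ t, T ≤ t → IsPole (q t) w := fun t ht => by
    induction t, ht using Nat.le_induction with
    | base => exact h0
    | succ t ht ih => rw [hq t ih]; exact ih.step hσ
  have hstay : ∀ t, T ≤ t → GatheredAt (q t) w → ∀ s, t ≤ s → GatheredAt (q s) w := by
    intro t ht hg s hs
    induction s, hs using Nat.le_induction with
    | base => exact hg
    | succ s hs ih =>
      intro i
      rw [hq s (hp s (ht.trans hs))]
      exact (hp s (ht.trans hs)).step_eq_of_eq hσ (ih i)
  suffices ∃ t, T ≤ t ∧ GatheredAt (q t) w by
    obtain ⟨t, ht, hg⟩ := this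
    exact ⟨t, hstay t ht hg⟩
  by_contra! hc
  refine not_forall_exists_lt_of_antitone (Φ := fun t => workload σ w (q (T + t)))
    (antitone_nat_of_succ_le fun t => ?_) fun t => ?_
  · have := hp (T + t) (by omega)
    change workload σ w (q (T + t + 1)) ≤ _
    rw [hq _ this]
    exact this.workload_step_le hσ
  · obtain ⟨i, hi, hci⟩ := exists_isClosest (hc (T + t) (by omega))
    obtain ⟨s, hs, -, hne⟩ := exists_first_move hfair (q := q) (T + t) i fun s hs e hstep => by
      have hps : IsPole (q s) w := e ▸ hp (T + t) (by omega)
      have h1 : q (s + 1) i = moveToward (σ i) (q s i) w := by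
        rw [hq s hps, hps.step_eq hσ, if_pos ⟨hs, e ▸ hci⟩]
      rw [hstep, e] at h1
      have h2 := dist_moveToward_lt (hσ i) hi
      rw [← h1] at h2
      exact lt_irrefl _ h2
    refine ⟨s - T, by omega, ?_⟩
    obtain ⟨r, rfl⟩ : ∃ r, s = T + r := ⟨s - T, by omega⟩
    have hps := hp (T + r) (by omega)
    rw [Nat.add_sub_cancel_left]
    change workload σ w (q (T + r + 1)) < _
    rw [hq _ hps] at hne ⊢
    exact hps.workload_step_lt hσ hne

end

/-! ### Configurations without a strict median -/

section

variable {n : ℕ} {p : Config n}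

/-- The sum is continuous and dominates the distance to one robot, hence is coercive. -/
theorem exists_median (hn : 0 < n) (p : Config n) :
    ∃ u, ∀ y, ∑ i, dist (p i) u ≤ ∑ i, dist (p i) y := by
  have hc : Continuous fun y => ∑ i, dist (p i) y := by fun_prop
  refine hc.exists_forall_le (Filter.tendsto_atTop_mono (fun y => ?_)
    (tendsto_dist_left_cocompact_atTop (p ⟨0, hn⟩)))
  exact Finset.single_le_sum (f := fun i => dist (p i) y) (fun _ _ => dist_nonneg)
    (Finset.mem_univ (⟨0, hn⟩ : Fin n))

theorem exists_two_medians (hn : 0 < n) (h : ¬ ∃ w, IsStrictMedian p w) :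
    ∃ u v, u ≠ v ∧ (∀ y, ∑ i, dist (p i) u ≤ ∑ i, dist (p i) y) ∧
      ∑ i, dist (p i) v = ∑ i, dist (p i) u := by
  obtain ⟨u, hu⟩ := exists_median hn p
  simp only [IsStrictMedian, not_exists, not_forall, not_lt] at h
  obtain ⟨v, hne, hv⟩ := h u
  exact ⟨u, v, Ne.symm hne, hu, le_antisymm hv (hu v)⟩

theorem exists_eq_add_smul_of_sameRay {u v x : Plane} (hne : u ≠ v)
    (h : SameRay ℝ (u - x) (v - x)) :
    ∃ s : ℝ, x = u + s • (v - u) ∧ (s ≤ 0 ∨ 1 ≤ s) := by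
  obtain ⟨a, b, ha, hb, hab, e1, e2⟩ := h.exists_eq_smul_add
  have e3 : v - u = (b - a) • (u - x + (v - x)) := by
    rw [sub_smul, ← e2, ← e1]; abel
  have hba : b - a ≠ 0 := fun h0 => hne (sub_eq_zero.1 (by rw [e3, h0, zero_smul])).symm
  refine ⟨-(a / (b - a)), ?_, ?_⟩
  · rw [e3, smul_smul, neg_mul, div_mul_cancel₀ _ hba, neg_smul, ← e1]; abel
  · rcases lt_or_gt_of_ne hba with h | h
    · right
      rw [← div_neg, le_div_iff₀ (by linarith)]; linarith
    · left
      have : 0 ≤ a / (b - a) := div_nonneg ha h.le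
      linarith

theorem exists_coordinates_of_two_medians {u v : Plane} (hne : u ≠ v)
    (hu : ∀ y, ∑ i, dist (p i) u ≤ ∑ i, dist (p i) y)
    (huv : ∑ i, dist (p i) v = ∑ i, dist (p i) u) :
    ∃ s : Fin n → ℝ, ∀ i, p i = u + s i • (v - u) ∧ (s i ≤ 0 ∨ 1 ≤ s i) := by
  have hmid : ∀ i, 2 * dist (p i) (midpoint ℝ u v) = ‖(u - p i) + (v - p i)‖ := fun i => by
    rw [dist_comm, dist_eq_norm, ← Real.norm_of_nonneg (zero_le_two (α := ℝ)), ← norm_smul,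
      midpoint_eq_smul_add]
    congr 1
    rw [smul_sub, smul_smul, mul_invOf_self, one_smul]
    module
  have hle : ∀ i ∈ Finset.univ, 2 * dist (p i) (midpoint ℝ u v) ≤ dist (p i) u + dist (p i) v :=
    fun i _ => by
      rw [hmid, dist_comm (p i) u, dist_comm (p i) v, dist_eq_norm, dist_eq_norm]
      exact norm_add_le _ _
  -- The midpoint of two minimizers cannot do better than they do, so the termwise triangle
  -- inequalities are all equalities.
  have hsum : ∑ i, 2 * dist (p i) (midpoint ℝ u v) = ∑ i, (dist (p i) u + dist (p i) v) := by
    refine le_antisymm (Finset.sum_le_sum hle) ?_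
    rw [Finset.sum_add_distrib, huv, ← Finset.mul_sum]
    linarith [hu (midpoint ℝ u v)]
  have heq := (Finset.sum_eq_sum_iff_of_le hle).1 hsum
  refine Classical.skolem.1 fun i => exists_eq_add_smul_of_sameRay hne ?_
  rw [sameRay_iff_norm_add, ← hmid, heq i (Finset.mem_univ i), dist_comm (p i) u,
    dist_comm (p i) v, dist_eq_norm, dist_eq_norm]

theorem exists_line (hn : 0 < n) (h : ¬ ∃ w, IsStrictMedian p w) :
    ∃ (b d : Plane) (s : Fin n → ℝ), ∀ i, p i = b + s i • d := by
  obtain ⟨u, v, hne, hu, huv⟩ := exists_two_medians hn h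
  obtain ⟨s, hs⟩ := exists_coordinates_of_two_medians hne hu huv
  exact ⟨u, v - u, s, fun i => (hs i).1⟩

theorem exists_lt_of_one_lt_card {s : Fin n → ℝ} (hs : Function.Injective s)
    {L : Finset (Fin n)} (h : 1 < L.card) : ∃ a ∈ L, ∃ b ∈ L, s a < s b := by
  obtain ⟨a, ha, b, hb, hab⟩ := Finset.one_lt_card.1 h
  rcases lt_or_gt_of_ne (hs.ne hab) with h | h
  · exact ⟨a, ha, b, hb, h⟩
  · exact ⟨b, hb, a, ha, h⟩

/-- Distinct robots without a strict median are on a line, at least four of them. -/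
theorem exists_four_on_line (hn : 3 ≤ n) (hp : Function.Injective p)
    (h : ¬ ∃ w, IsStrictMedian p w) :
    ∃ (b d : Plane) (s : Fin n → ℝ), d ≠ 0 ∧ (∀ i, p i = b + s i • d) ∧
      ∃ i j k l, s i < s j ∧ s j < s k ∧ s k < s l := by
  obtain ⟨u, v, hne, hu, huv⟩ := exists_two_medians (by omega) h
  obtain ⟨s, hs⟩ := exists_coordinates_of_two_medians hne hu huv
  refine ⟨u, v - u, s, sub_ne_zero.2 hne.symm, fun i => (hs i).1, ?_⟩
  have hinj : Function.Injective s := fun i j e => hp (by rw [(hs i).1, (hs j).1, e])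
  have hd : 0 < ‖v - u‖ := norm_pos_iff.2 (sub_ne_zero.2 hne.symm)
  -- No robot lies strictly between `u` and `v`, so going from `u` to `v` changes each distance by
  -- exactly plus or minus `‖v - u‖`. The changes cancel, so both sides hold equally many robots; as
  -- `3 ≤ n`, each holds at least two.
  have hterm : ∀ i, dist (p i) v - dist (p i) u = (if s i ≤ 0 then 1 else -1) * ‖v - u‖ := by
    intro i
    have e1 : p i - v = (s i - 1) • (v - u) := by rw [(hs i).1]; module
    have e2 : p i - u = s i • (v - u) := by rw [(hs i).1]; module
    rw [dist_eq_norm, dist_eq_norm, e1, e2, norm_smul, norm_smul, Real.norm_eq_abs,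
      Real.norm_eq_abs, ← sub_mul]
    congr 1
    split_ifs with h0
    · rw [abs_of_nonpos h0, abs_of_nonpos (by linarith)]; ring
    · have := (hs i).2.resolve_left h0
      rw [abs_of_nonneg (by linarith), abs_of_nonneg (by linarith)]; ring
  have hzero : ∑ i, (if s i ≤ 0 then (1 : ℝ) else -1) = 0 := by
    have : ∑ i, (dist (p i) v - dist (p i) u) = 0 := by rw [Finset.sum_sub_distrib, huv, sub_self]
    simp only [hterm, ← Finset.sum_mul] at this
    exact (mul_eq_zero.1 this).resolve_right hd.ne'
  rw [Finset.sum_ite, Finset.sum_const, Finset.sum_const, nsmul_eq_mul, nsmul_eq_mul, mul_one,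
    mul_neg_one, ← sub_eq_add_neg, sub_eq_zero, Nat.cast_inj] at hzero
  have htot := Finset.card_filter_add_card_filter_not (s := (Finset.univ : Finset (Fin n)))
    (fun i => s i ≤ 0)
  rw [Finset.card_univ, Fintype.card_fin] at htot
  obtain ⟨i, -, j, hj, hij⟩ := exists_lt_of_one_lt_card hinj
    (L := Finset.univ.filter fun i => s i ≤ 0) (by omega)
  obtain ⟨k, hk, l, -, hkl⟩ := exists_lt_of_one_lt_card hinj
    (L := Finset.univ.filter fun i => ¬ s i ≤ 0) (by omega)
  simp only [Finset.mem_filter, Finset.mem_univ, true_and, not_le] at hj hk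
  exact ⟨i, j, k, l, hij, hj.trans_lt hk, hkl⟩

theorem exists_ne_zero_inner_eq_zero (d : Plane) : ∃ e : Plane, e ≠ 0 ∧ inner ℝ e d = (0 : ℝ) := by
  by_cases hd : d = 0
  · exact ⟨EuclideanSpace.single 0 1, by simp, by simp [hd]⟩
  · refine ⟨!₂[-d 1, d 0], fun h => hd ?_, ?_⟩
    · ext k
      have h0 := congrArg (fun x : Plane => x 0) h
      have h1 := congrArg (fun x : Plane => x 1) h
      fin_cases k <;> simp_all
    · simp [PiLp.inner_apply, Fin.sum_univ_two]
      ring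

/-! ### Leaving the line -/

/-- The robot `i` is at an end of the line of the robots. -/
def IsExtreme (p : Config n) (i : Fin n) : Prop :=
  ∀ j k, (0 : ℝ) ≤ inner ℝ (p j - p i) (p k - p i)

theorem inner_sub_sub_of_line {b d : Plane} {s : Fin n → ℝ} (hs : ∀ i, p i = b + s i • d)
    (i j k : Fin n) :
    inner ℝ (p j - p i) (p k - p i) = (s j - s i) * (s k - s i) * inner ℝ d d := by
  have e : ∀ j, p j - p i = (s j - s i) • d := fun j => by rw [hs, hs]; module
  rw [e, e, real_inner_smul_left, real_inner_smul_right]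
  ring

theorem not_isExtreme_of_line {b d : Plane} {s : Fin n → ℝ} (hd : d ≠ 0)
    (hs : ∀ i, p i = b + s i • d) {i j k : Fin n} (hj : s j < s i) (hk : s i < s k) :
    ¬ IsExtreme p i := by
  intro h
  have := h j k
  rw [inner_sub_sub_of_line hs] at this
  have hdd : (0 : ℝ) < inner ℝ d d := real_inner_self_pos.2 hd
  have : 0 < (s i - s j) * (s k - s i) * inner ℝ d d :=
    mul_pos (mul_pos (by linarith) (by linarith)) hdd
  linarith

theorem exists_isExtreme_of_line (hn : 0 < n) {b d : Plane} {s : Fin n → ℝ}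
    (hs : ∀ i, p i = b + s i • d) : ∃ i, IsExtreme p i := by
  obtain ⟨i, -, hi⟩ := Finset.univ.exists_min_image s ⟨(⟨0, hn⟩ : Fin n), Finset.mem_univ _⟩
  refine ⟨i, fun j k => ?_⟩
  rw [inner_sub_sub_of_line hs]
  have hj := hi j (Finset.mem_univ j)
  have hk := hi k (Finset.mem_univ k)
  exact mul_nonneg (mul_nonneg (by linarith) (by linarith)) real_inner_self_nonneg

theorem gatherAlg_view_eq_sidestep (F : Frame) (hp : Function.Injective p)
    (h : ¬ ∃ w, IsStrictMedian p w) (i : Fin n) :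
    gatherAlg (view F p i) = sidestep (view F p i) := by
  refine dif_neg ?_
  rintro ⟨w, hw⟩
  rw [← F.toLocal_toGlobal (p i) w, isTarget_view_of_injective F hp] at hw
  exact h ⟨_, hw⟩

theorem extreme_view_iff (F : Frame) (i : Fin n) :
    (∀ x ∈ (view F p i).occupied, ∀ y ∈ (view F p i).occupied, (0 : ℝ) ≤ inner ℝ x y) ↔
      IsExtreme p i := by
  simp only [mem_occupied, forall_exists_index, forall_apply_eq_imp_iff, IsExtreme,
    F.inner_toLocal]
  have hu : 0 < F.unit⁻¹ := inv_pos.2 F.unit_pos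
  simp only [mul_nonneg_iff_of_pos_left hu]

theorem Frame.inner_toGlobal_sub (F : Frame) (x q r : Plane) :
    inner ℝ (F.toGlobal q x - q) (r - q) = F.unit * (F.unit * inner ℝ x (F.toLocal q r)) := by
  rw [Frame.toGlobal, add_sub_cancel_left, Frame.toLocal, real_inner_smul_left,
    real_inner_smul_right, ← F.axes.inner_map_map, F.axes.apply_symm_apply,
    mul_inv_cancel_left₀ F.unit_pos.ne']

theorem toGlobal_sidestep_of_not_isExtreme (F : Frame) {i : Fin n} (h : ¬ IsExtreme p i) :
    F.toGlobal (p i) (sidestep (view F p i)) = p i := by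
  rw [sidestep, dif_neg, F.toGlobal_zero]
  exact fun hc => h ((extreme_view_iff F i).1 hc.1)

theorem toGlobal_sidestep_of_isExtreme (F : Frame) {b d : Plane} {s : Fin n → ℝ}
    (hs : ∀ i, p i = b + s i • d) {i : Fin n} (h : IsExtreme p i) :
    F.toGlobal (p i) (sidestep (view F p i)) ≠ p i ∧
      ∀ j, inner ℝ (F.toGlobal (p i) (sidestep (view F p i)) - p i) (p j - p i) = (0 : ℝ) := by
  have hex : ∃ u : Plane, u ≠ 0 ∧ ∀ x ∈ (view F p i).occupied, inner ℝ u x = (0 : ℝ) := by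
    obtain ⟨e, he, hed⟩ := exists_ne_zero_inner_eq_zero d
    refine ⟨F.axes e, by simpa using he, fun x hx => ?_⟩
    obtain ⟨j, rfl⟩ := (mem_occupied F p i).1 hx
    have e1 : p j - p i = (s j - s i) • d := by rw [hs, hs]; module
    rw [Frame.toLocal, real_inner_smul_right, F.axes.inner_map_map, e1, real_inner_smul_right,
      hed, mul_zero, mul_zero]
  have hcond := And.intro ((extreme_view_iff F i).2 h) hex
  rw [sidestep, dif_pos hcond]
  obtain ⟨h0, hperp⟩ := hcond.2.choose_spec
  refine ⟨fun e => h0 ?_, fun j => ?_⟩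
  · rw [← F.toLocal_toGlobal (p i) (Exists.choose _), e, F.toLocal_self]
  · rw [F.inner_toGlobal_sub, hperp _ ((mem_occupied F p i).2 ⟨j, rfl⟩), mul_zero, mul_zero]

variable {F : Fin n → Frame} {σ : Fin n → ℝ} {act : Finset (Fin n)} {coin : Fin n → Fin 2}

theorem step_of_not_isExtreme (hσ : ∀ i, 0 < σ i) (hp : Function.Injective p)
    (h : ¬ ∃ w, IsStrictMedian p w) {i : Fin n} (hi : ¬ IsExtreme p i) :
    step gatherAlg.toProtocol F σ act coin p i = p i := by
  simp only [step, DetAlgorithm.toProtocol, gatherAlg_view_eq_sidestep (F i) hp h,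
    toGlobal_sidestep_of_not_isExtreme (F i) hi, moveToward_self _ (hσ i).le, ite_self]

theorem step_ne_of_isExtreme (hσ : ∀ i, 0 < σ i) (hp : Function.Injective p)
    (h : ¬ ∃ w, IsStrictMedian p w) {b d : Plane} {s : Fin n → ℝ} (hs : ∀ i, p i = b + s i • d)
    {i : Fin n} (hi : IsExtreme p i) (ha : i ∈ act) :
    step gatherAlg.toProtocol F σ act coin p i ≠ p i := by
  simp only [step, DetAlgorithm.toProtocol, gatherAlg_view_eq_sidestep (F i) hp h, if_pos ha]
  obtain ⟨a, ha, -, e⟩ := exists_moveToward_eq (hσ i) (p i)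
    ((F i).toGlobal (p i) (sidestep (view (F i) p i)))
  rw [e, Ne, add_eq_left, smul_eq_zero, sub_eq_zero, not_or]
  exact ⟨ha.ne', (toGlobal_sidestep_of_isExtreme (F i) hs hi).1⟩

theorem inner_step_sub (hσ : ∀ i, 0 < σ i) (hp : Function.Injective p)
    (h : ¬ ∃ w, IsStrictMedian p w) {b d : Plane} {s : Fin n → ℝ} (hs : ∀ i, p i = b + s i • d)
    (i j : Fin n) :
    inner ℝ (step gatherAlg.toProtocol F σ act coin p i - p i) (p j - p i) = (0 : ℝ) := by
  by_cases hi : IsExtreme p i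
  · simp only [step, DetAlgorithm.toProtocol, gatherAlg_view_eq_sidestep (F i) hp h]
    split_ifs
    · obtain ⟨a, -, -, e⟩ := exists_moveToward_eq (hσ i) (p i)
        ((F i).toGlobal (p i) (sidestep (view (F i) p i)))
      rw [e, add_sub_cancel_left, real_inner_smul_left,
        (toGlobal_sidestep_of_isExtreme (F i) hs hi).2 j, mul_zero]
    · rw [sub_self, inner_zero_left]
  · rw [step_of_not_isExtreme hσ hp h hi, sub_self, inner_zero_left]

/-- Displacements are perpendicular to the line, so projections onto it are kept and the robots stay
distinct. A new common line would pass through two unmoved inner robots, hence be the old one. -/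
theorem sidestep_step (hn : 3 ≤ n) (hσ : ∀ i, 0 < σ i) (hp : Function.Injective p)
    (h : ¬ ∃ w, IsStrictMedian p w) (hne : step gatherAlg.toProtocol F σ act coin p ≠ p) :
    ∃ w, IsPole (step gatherAlg.toProtocol F σ act coin p) w := by
  obtain ⟨b, d, s, hd, hs, i₁, i₂, i₃, i₄, h12, h23, h34⟩ := exists_four_on_line hn hp h
  set q := step gatherAlg.toProtocol F σ act coin p with hq
  have hsub : ∀ i j, p j - p i = (s j - s i) • d := fun i j => by rw [hs, hs]; module
  have hdd : (0 : ℝ) < inner ℝ d d := real_inner_self_pos.2 hd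
  have hperp : ∀ i, inner ℝ (q i - p i) d = (0 : ℝ) := fun i => by
    obtain ⟨j, hj⟩ : ∃ j, s j ≠ s i := by
      by_contra! hc
      exact h12.ne ((hc i₁).trans (hc i₂).symm)
    have := inner_step_sub (F := F) (act := act) (coin := coin) hσ hp h hs i j
    rw [hsub, real_inner_smul_right] at this
    exact (mul_eq_zero.1 this).resolve_left (sub_ne_zero.2 hj)
  have hqinj : Function.Injective q := fun i j hij => by
    have e : (q i - p i) - (q j - p j) = (s j - s i) • d := by rw [hij, ← hsub]; abel
    have := congrArg (fun x => inner ℝ x d) e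
    simp only [inner_sub_left, hperp, sub_zero, real_inner_smul_left] at this
    have hsij : s j - s i = 0 := (mul_eq_zero.1 this.symm).resolve_right hdd.ne'
    exact hp (by rw [hs i, hs j, sub_eq_zero.1 hsij])
  suffices hmed : ∃ w, IsStrictMedian q w by
    obtain ⟨w, hw⟩ := hmed
    exact ⟨w, fun i j hij e => absurd (hqinj e) hij, Or.inr hw⟩
  by_contra hno
  obtain ⟨b', d', s', hs'⟩ := exists_line (by omega) hno
  have hsub' : ∀ i j, q j - q i = (s' j - s' i) • d' := fun i j => by rw [hs', hs']; module
  have e2 : q i₂ = p i₂ := step_of_not_isExtreme hσ hp h (not_isExtreme_of_line hd hs h12 h23)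
  have e3 : q i₃ = p i₃ := step_of_not_isExtreme hσ hp h (not_isExtreme_of_line hd hs h23 h34)
  obtain ⟨i, hi⟩ := Function.ne_iff.1 hne
  -- The displacement of `i` is a combination of `d` and `d'` and is orthogonal to both, hence to
  -- itself.
  refine hi (sub_eq_zero.1 (inner_self_eq_zero (𝕜 := ℝ).1 ?_))
  have hdir : (s i₃ - s i₂) • d = (s' i₃ - s' i₂) • d' := by rw [← hsub, ← hsub', e2, e3]
  have hc : s i₃ - s i₂ ≠ 0 := by linarith
  have hd' : inner ℝ (q i - p i) d' = (0 : ℝ) := by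
    have h1 := congrArg (fun x => inner ℝ (q i - p i) x) hdir
    simp only [real_inner_smul_right, hperp, mul_zero] at h1
    refine (mul_eq_zero.1 h1.symm).resolve_left fun h0 => hd ?_
    rw [h0, zero_smul] at hdir
    exact (smul_eq_zero.1 hdir).resolve_left hc
  have e : q i - p i = (s' i - s' i₂) • d' - (s i - s i₂) • d := by
    rw [← hsub, ← hsub', e2]; abel
  calc inner ℝ (q i - p i) (q i - p i)
      = inner ℝ (q i - p i) ((s' i - s' i₂) • d' - (s i - s i₂) • d) := by rw [← e]
    _ = 0 := by rw [inner_sub_right, real_inner_smul_right, real_inner_smul_right, hperp, hd']; ring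

end

/-! ### Gathering without multiple positions to scatter -/

section

variable {n : ℕ}

theorem exists_isPole_of_not_injective {p : Config n} (h : ¬ ManyMultiple p)
    (hp : ¬ Function.Injective p) : ∃ w, IsPole p w := by
  simp only [Function.Injective, not_forall] at hp
  obtain ⟨a, b, hab, hne⟩ := hp
  refine ⟨p a, fun i j hij e => ?_, Or.inl ⟨a, b, hne, rfl, hab.symm⟩⟩
  by_contra hd
  exact h ⟨i, j, a, b, hij, hne, e, hab, hd⟩

theorem IsPole.not_manyMultiple {p : Config n} {w : Plane} (h : IsPole p w) : ¬ ManyMultiple p := by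
  rintro ⟨i, j, k, l, hij, hkl, e, e', hne⟩
  exact hne ((h.eq_of_ne i j hij e).trans (h.eq_of_ne k l hkl e').symm)

theorem not_manyMultiple_of_injective {p : Config n} (h : Function.Injective p) :
    ¬ ManyMultiple p := by
  rintro ⟨i, j, k, l, hij, hkl, e, e', hne⟩
  exact hij (h e)

/-- A run that follows the algorithm whenever at most one position is multiple gathers, as soon as
it reaches such a configuration. -/
theorem eventually_gatheredAt (hn : 3 ≤ n) {F : Fin n → Frame} {σ : Fin n → ℝ}
    (hσ : ∀ i, 0 < σ i) {act : ℕ → Finset (Fin n)} {coin : ℕ → Fin n → Fin 2} (hfair : IsFair act)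
    {q : ℕ → Config n} (hq : ∀ t, ¬ ManyMultiple (q t) →
      q (t + 1) = step gatherAlg.toProtocol F σ (act t) (coin t) (q t))
    {T : ℕ} (hT : ¬ ManyMultiple (q T)) :
    ∃ (T' : ℕ) (x : Plane), ∀ t, T' ≤ t → GatheredAt (q t) x := by
  suffices ∃ t w, IsPole (q t) w by
    obtain ⟨t, w, hw⟩ := this
    obtain ⟨T', hT'⟩ := hw.eventually_gatheredAt hσ hfair fun t h => hq t h.not_manyMultiple
    exact ⟨T', w, hT'⟩
  by_cases hp : Function.Injective (q T)
  swap
  · exact ⟨T, exists_isPole_of_not_injective hT hp⟩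
  by_cases hm : ∃ w, IsStrictMedian (q T) w
  · obtain ⟨w, hw⟩ := hm
    exact ⟨T, w, fun i j hij e => absurd (hp e) hij, Or.inr hw⟩
  obtain ⟨b, d, s, hs⟩ := exists_line (by omega) hm
  obtain ⟨i, hi⟩ := exists_isExtreme_of_line (by omega) hs
  obtain ⟨r, -, hr, hne⟩ := exists_first_move hfair (q := q) T i fun r hr e hstep => by
    have h1 := congrFun (hq r (e ▸ hT)) i
    rw [hstep, e] at h1
    exact step_ne_of_isExtreme hσ hp hm hs hi hr h1.symm
  have h1 := hq r (hr ▸ hT)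
  rw [h1, hr] at hne
  obtain ⟨w, hw⟩ := sidestep_step hn hσ hp hm hne
  exact ⟨r + 1, w, by rw [h1, hr]; exact hw⟩

theorem gatherAlg_detGatheringFromDistinct (hn : 3 ≤ n) : DetGatheringFromDistinct n gatherAlg :=
  fun _ _ hσ p₀ hp _ _ _ hfair => eventually_gatheredAt hn hσ hfair (T := 0)
    (fun _ _ => rfl) (not_manyMultiple_of_injective (p := p₀) hp)

end

/-! ### Coins that come up infinitely often -/

section Probability

variable {n : ℕ} {Ω : Type} [mΩ : MeasurableSpace Ω] {μ : Measure Ω}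

/-- `U` is arbitrary: the configuration at time `t` depends only on finitely many activations and
coins, each with finitely many values. -/
theorem RandomSchedule.measurableSet_run (S : RandomSchedule μ n) (P : Protocol)
    (F : Fin n → Frame) (σ : Fin n → ℝ) (p₀ : Config n) (t : ℕ) (U : Set (Config n)) :
    MeasurableSet[S.past t]
      {ω | run P F σ p₀ (fun s => S.act s ω) (fun s => S.coin s ω) t ∈ U} := by
  induction t generalizing U with
  | zero => exact @MeasurableSet.const _ (S.past 0) (p₀ ∈ U)
  | succ t ih =>
    have hle : S.past t ≤ S.past (t + 1) := S.past.mono (Nat.le_succ t)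
    have e : {ω | run P F σ p₀ (fun s => S.act s ω) (fun s => S.coin s ω) (t + 1) ∈ U} =
        ⋃ (a : Finset (Fin n)) (c : Fin n → Fin 2), {ω | S.act t ω = a} ∩ {ω | S.coin t ω = c} ∩
          {ω | run P F σ p₀ (fun s => S.act s ω) (fun s => S.coin s ω) t ∈
            {p | step P F σ a c p ∈ U}} := by
      ext ω
      simp only [Set.mem_iUnion, Set.mem_inter_iff, Set.mem_ofPred_eq, run]
      constructor
      · exact fun h => ⟨_, _, ⟨rfl, rfl⟩, h⟩
      · rintro ⟨_, _, ⟨rfl, rfl⟩, h⟩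
        exact h
    rw [e]
    exact MeasurableSet.iUnion fun a => MeasurableSet.iUnion fun c =>
      ((hle _ (S.act_measurable t a)).inter (S.coin_measurable t c)).inter (hle _ (ih _))

theorem RandomSchedule.measurableSet_run_act (S : RandomSchedule μ n) (P : Protocol)
    (F : Fin n → Frame) (σ : Fin n → ℝ) (p₀ : Config n) (t : ℕ)
    (B : Config n → Finset (Fin n) → Prop) :
    MeasurableSet[S.past t]
      {ω | B (run P F σ p₀ (fun s => S.act s ω) (fun s => S.coin s ω) t) (S.act t ω)} := by
  have e : {ω | B (run P F σ p₀ (fun s => S.act s ω) (fun s => S.coin s ω) t) (S.act t ω)} =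
      ⋃ a : Finset (Fin n), {ω | S.act t ω = a} ∩
        {ω | run P F σ p₀ (fun s => S.act s ω) (fun s => S.coin s ω) t ∈ {p | B p a}} := by
    ext ω
    simp
  rw [e]
  exact MeasurableSet.iUnion fun a => (S.act_measurable t a).inter (S.measurableSet_run ..)

/-- The probability that the coins drawn at time `t` take predictable values. -/
theorem RandomSchedule.measure_coin_eq_inter (S : RandomSchedule μ n) (t : ℕ)
    (c : Ω → Fin n → Fin 2) (hc : ∀ a, MeasurableSet[S.past t] {ω | c ω = a})
    {E : Set Ω} (hE : MeasurableSet[S.past t] E) :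
    μ ({ω | S.coin t ω = c ω} ∩ E) = (2⁻¹ : ENNReal) ^ n * μ E := by
  have hle : S.past t ≤ mΩ := S.past.le t
  have hle' : S.past (t + 1) ≤ mΩ := S.past.le (t + 1)
  have hcE : ∀ a, MeasurableSet[S.past t] ({ω | c ω = a} ∩ E) := fun a => (hc a).inter hE
  have e1 : {ω | S.coin t ω = c ω} ∩ E =
      ⋃ a, {ω | S.coin t ω = a} ∩ ({ω | c ω = a} ∩ E) := by
    ext ω
    simp [eq_comm]
  have e2 : E = ⋃ a, {ω | c ω = a} ∩ E := by
    ext ω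
    simp
  have hdisj : Pairwise (Function.onFun Disjoint fun a => {ω | c ω = a} ∩ E) := fun a b hab =>
    Set.disjoint_left.2 fun ω h1 h2 => hab (h1.1.symm.trans h2.1)
  rw [e1, measure_iUnion (fun a b hab => (hdisj hab).mono Set.inter_subset_right
    Set.inter_subset_right) fun a => (hle' _ (S.coin_measurable t a)).inter (hle _ (hcE a))]
  conv_rhs => rw [e2, measure_iUnion hdisj fun a => hle _ (hcE a), ← ENNReal.tsum_mul_left]
  exact tsum_congr fun a => S.coin_uniform t a _ (hcE a)

/-- If a predictable event `B` occurs infinitely often, then almost surely it occurs infinitely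
often together with predictable values `c` of the coins. -/
theorem RandomSchedule.ae_frequently_coin_eq [IsProbabilityMeasure μ] (S : RandomSchedule μ n)
    (P : Protocol) (F : Fin n → Frame) (σ : Fin n → ℝ) (p₀ : Config n)
    (B : Config n → Finset (Fin n) → Prop) (c : Config n → Finset (Fin n) → Fin n → Fin 2) :
    ∀ᵐ ω ∂μ,
      (∀ t, ∃ s, t ≤ s ∧
        B (run P F σ p₀ (fun s => S.act s ω) (fun s => S.coin s ω) s) (S.act s ω)) →
      ∀ t, ∃ s, t ≤ s ∧
        B (run P F σ p₀ (fun s => S.act s ω) (fun s => S.coin s ω) s) (S.act s ω) ∧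
        S.coin s ω = c (run P F σ p₀ (fun s => S.act s ω) (fun s => S.coin s ω) s) (S.act s ω) := by
  set q : ℕ → Ω → Config n :=
    fun t ω => run P F σ p₀ (fun s => S.act s ω) (fun s => S.coin s ω) t with hq
  let C : ℕ → Set Ω := fun t => {ω | S.coin t ω = c (q t ω) (S.act t ω)}
  let D : ℕ → Set Ω := fun t => {ω | B (q t ω) (S.act t ω)}
  -- Coins of time `t` are known only at time `t + 1`, hence the shift by one and the empty event at
  -- 0.
  let G : ℕ → Set Ω := fun t => Nat.casesOn t ∅ fun t => C t ∩ D t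
  have hD : ∀ t, MeasurableSet[S.past t] (D t) := fun t => S.measurableSet_run_act P F σ p₀ t B
  have hc : ∀ t a, MeasurableSet[S.past t] {ω | c (q t ω) (S.act t ω) = a} := fun t a =>
    S.measurableSet_run_act P F σ p₀ t fun p b => c p b = a
  have hC : ∀ t, MeasurableSet[S.past (t + 1)] (C t) := fun t => by
    have e : C t = ⋃ a, {ω | S.coin t ω = a} ∩ {ω | c (q t ω) (S.act t ω) = a} := by
      ext ω
      simp [C, eq_comm]
    rw [e]
    exact MeasurableSet.iUnion fun a =>
      (S.coin_measurable t a).inter (S.past.mono (Nat.le_succ t) _ (hc t a))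
  have hG : ∀ t, MeasurableSet[S.past t] (G t) := fun t => by
    cases t with
    | zero => exact @MeasurableSet.empty _ (S.past 0)
    | succ t => exact (hC t).inter (S.past.mono (Nat.le_succ t) _ (hD t))
  have hr : (0 : ℝ) < 2⁻¹ ^ n := by positivity
  -- Given the past, the prescribed coins have probability $2^{-n}$ on `D t`, so the conditional
  -- probabilities in Lévy's criterion sum to infinity exactly when `D` occurs infinitely often.
  have hcond : ∀ t, (D t).indicator (fun _ => (2⁻¹ : ℝ) ^ n) =ᵐ[μ]
      μ[(G (t + 1)).indicator (1 : Ω → ℝ) | S.past t] := fun t => by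
    have hle := S.past.le t
    refine ae_eq_condExp_of_forall_setIntegral_eq hle
      ((integrable_const 1).indicator (S.past.le (t + 1) _ (hG (t + 1)))) (fun E hE _ =>
        ((integrable_const _).indicator (hle _ (hD t))).integrableOn) (fun E hE _ => ?_)
      (stronglyMeasurable_const.indicator (hD t)).aestronglyMeasurable
    have h1 := S.measure_coin_eq_inter t _ (hc t) ((hD t).inter hE)
    rw [setIntegral_indicator (hle _ (hD t)),
      setIntegral_indicator (S.past.le (t + 1) _ (hG (t + 1)))]
    change _ = ∫ _ in E ∩ (C t ∩ D t), (1 : ℝ) ∂μ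
    rw [setIntegral_const, setIntegral_const, smul_eq_mul, smul_eq_mul, mul_one, mul_comm,
      Set.inter_comm E, Set.inter_comm E, Set.inter_assoc, measureReal_def, measureReal_def, h1,
      ENNReal.toReal_mul, ENNReal.toReal_pow, ENNReal.toReal_inv, ENNReal.toReal_ofNat]
  filter_upwards [ae_mem_limsup_atTop_iff μ hG, ae_all_iff.2 hcond] with ω hω hcω hinf t
  have hfreq : ω ∈ Filter.limsup G Filter.atTop := by
    rw [hω]
    have hD' : ω ∈ Filter.limsup D Filter.atTop := by
      rw [Filter.mem_limsup_iff_frequently_mem, Filter.frequently_atTop]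
      exact hinf
    rw [Set.limsup_eq_tendsto_sum_indicator_atTop hr] at hD'
    refine Filter.Tendsto.congr (fun N => Finset.sum_congr rfl fun k _ => hcω k) hD'
  rw [Filter.mem_limsup_iff_frequently_mem, Filter.frequently_atTop] at hfreq
  obtain ⟨s, hs, hsG⟩ := hfreq (t + 1)
  obtain ⟨s, rfl⟩ : ∃ r, s = r + 1 := ⟨s - 1, by omega⟩
  exact ⟨s, by omega, hsG.2, hsG.1⟩

end Probability

/-- The coins that make only the robot `i` draw `0`. -/
def soleCoin {n : ℕ} (i : Fin n) : Fin n → Fin 2 := fun j => if j = i then 0 else 1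

/-! ### Scattering -/

/-- The cell of the origin is given by finitely many open conditions true at 0, and 0 is not
isolated in the plane. -/
theorem exists_isCellChoice : ∃ c, IsCellChoice c := by
  suffices h : ∀ v : View, ∃ x, x ∈ voronoiCell v.occupied 0 ∧ x ≠ 0 from Classical.skolem.1 h
  intro v
  have h1 : ∀ᶠ x in nhds (0 : Plane), ∀ y ∈ v.occupied, y ≠ 0 → dist x 0 < dist x y := by
    rw [Finset.eventually_all]
    intro y _
    by_cases hy : y = 0
    · simp [hy]
    · have h := ContinuousAt.eventually_lt (x₀ := (0 : Plane)) (f := fun x => dist x 0)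
        (g := fun x => dist x y) (by fun_prop) (by fun_prop)
        (by rw [dist_self]; exact dist_pos.2 (Ne.symm hy))
      exact h.mono fun x hx _ => hx
  obtain ⟨x, hx, hx0⟩ := ((h1.filter_mono nhdsWithin_le_nhds).and
    (self_mem_nhdsWithin : {(0 : Plane)}ᶜ ∈ nhdsWithin 0 _)).exists
  exact ⟨x, hx, hx0⟩

section Scatter

variable {n : ℕ} {c : View → Plane} {F : Fin n → Frame} {σ : Fin n → ℝ} {act : Finset (Fin n)}
  {coin : Fin n → Fin 2} {p : Config n}

theorem IsCellChoice.dist_toGlobal_lt (hc : IsCellChoice c) (F : Frame) {i j : Fin n}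
    (hij : p j ≠ p i) : dist (p i) (F.toGlobal (p i) (c (view F p i))) <
      dist (p j) (F.toGlobal (p i) (c (view F p i))) := by
  have h := (hc (view F p i)).1 _ ((mem_occupied F p i).2 ⟨j, rfl⟩)
    (fun h => hij (F.toLocal_eq_zero.1 h))
  rw [← F.toLocal_toGlobal (p i) (c (view F p i)), ← F.toLocal_self (p i), F.dist_toLocal,
    F.dist_toLocal] at h
  rw [dist_comm (p i), dist_comm (p j)]
  exact lt_of_mul_lt_mul_left h (inv_pos.2 F.unit_pos).le

/-- A cell is star-shaped about its centre, so a move cut short by the travel bound still ends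
inside it. -/
theorem dist_moveToward_lt_dist {s : ℝ} (hs : 0 < s) {x y g : Plane} (h : dist x g < dist y g) :
    dist x (moveToward s x g) < dist y (moveToward s x g) := by
  have h1 := dist_moveToward_add hs x g
  have h2 := dist_triangle y (moveToward s x g) g
  linarith

theorem IsCellChoice.dist_step_lt (hc : IsCellChoice c) (hσ : ∀ i, 0 < σ i) {i j : Fin n}
    (hij : p j ≠ p i) : dist (p i) (step (procSP c) F σ act coin p i) <
      dist (p j) (step (procSP c) F σ act coin p i) := by
  have h0 : dist (p i) (p i) < dist (p j) (p i) := by rwa [dist_self, dist_pos]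
  unfold step procSP
  split_ifs
  · exact dist_moveToward_lt_dist (hσ i) (hc.dist_toGlobal_lt (F i) hij)
  · rwa [Frame.toGlobal_zero, moveToward_self _ (hσ i).le]
  · exact h0

theorem IsCellChoice.eq_of_step_eq (hc : IsCellChoice c) (hσ : ∀ i, 0 < σ i) {i j : Fin n}
    (h : step (procSP c) F σ act coin p i = step (procSP c) F σ act coin p j) : p i = p j := by
  by_contra hne
  have h1 := hc.dist_step_lt (F := F) (act := act) (coin := coin) hσ (Ne.symm hne)
  have h2 := hc.dist_step_lt (F := F) (act := act) (coin := coin) hσ hne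
  rw [h] at h1
  exact lt_asymm h1 h2

theorem IsCellChoice.step_soleCoin_ne (hc : IsCellChoice c) (hσ : ∀ i, 0 < σ i) {i j : Fin n}
    (hi : i ∈ act) (hij : j ≠ i) (h : p j = p i) :
    step (procSP c) F σ act (soleCoin i) p i ≠ step (procSP c) F σ act (soleCoin i) p j := by
  have hj : step (procSP c) F σ act (soleCoin i) p j = p j := by
    simp [step, procSP, soleCoin, hij, Frame.toGlobal_zero, moveToward_self _ (hσ j).le]
  rw [hj, h]
  obtain ⟨a, ha, -, e⟩ := exists_moveToward_eq (hσ i) (p i)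
    ((F i).toGlobal (p i) (c (view (F i) p i)))
  simp only [step, procSP, soleCoin, hi, if_true]
  rw [e, Ne, add_eq_left, smul_eq_zero, sub_eq_zero, not_or]
  refine ⟨ha.ne', fun e => (hc (view (F i) p i)).2 ?_⟩
  rw [← (F i).toLocal_toGlobal (p i) (c _), e, (F i).toLocal_self]

/-- The number of pairs of robots that are together. -/
def coincidences (p : Config n) : ℕ :=
  (Finset.univ.filter fun x : Fin n × Fin n => p x.1 = p x.2).card

/-- Some active robot shares its position. -/
def ActiveMultiple (p : Config n) (act : Finset (Fin n)) : Prop :=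
  ∃ i, i ∈ act ∧ ∃ j, j ≠ i ∧ p j = p i

/-- The coins that separate an active robot from those at the same position. -/
def separatingCoin (p : Config n) (act : Finset (Fin n)) : Fin n → Fin 2 :=
  if h : ActiveMultiple p act then soleCoin h.choose else 0

theorem IsCellChoice.coincidences_step_le (hc : IsCellChoice c) (hσ : ∀ i, 0 < σ i) :
    coincidences (step (procSP c) F σ act coin p) ≤ coincidences p := by
  refine Finset.card_le_card fun x hx => ?_
  simp only [Finset.mem_filter, Finset.mem_univ, true_and] at hx ⊢
  exact hc.eq_of_step_eq hσ hx

theorem IsCellChoice.coincidences_step_lt (hc : IsCellChoice c) (hσ : ∀ i, 0 < σ i)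
    (h : ActiveMultiple p act) :
    coincidences (step (procSP c) F σ act (separatingCoin p act) p) < coincidences p := by
  rw [separatingCoin, dif_pos h]
  obtain ⟨hi, j, hj, e⟩ := h.choose_spec
  refine Finset.card_lt_card (Finset.ssubset_iff_of_subset (fun x hx => ?_) |>.2
    ⟨(h.choose, j), ?_, ?_⟩)
  · simp only [Finset.mem_filter, Finset.mem_univ, true_and] at hx ⊢
    exact hc.eq_of_step_eq hσ hx
  · simpa using e.symm
  · simpa using hc.step_soleCoin_ne hσ hi hj e

/-- Scattering ends if separating coins come up infinitely often. -/
theorem IsCellChoice.exists_not_manyMultiple (hc : IsCellChoice c) (hσ : ∀ i, 0 < σ i)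
    {act : ℕ → Finset (Fin n)} {coin : ℕ → Fin n → Fin 2} (hfair : IsFair act) {q : ℕ → Config n}
    (hq : ∀ t, ManyMultiple (q t) → q (t + 1) = step (procSP c) F σ (act t) (coin t) (q t))
    (hcoin : (∀ t, ∃ s, t ≤ s ∧ ActiveMultiple (q s) (act s)) →
      ∀ t, ∃ s, t ≤ s ∧ ActiveMultiple (q s) (act s) ∧ coin s = separatingCoin (q s) (act s)) :
    ∃ t, ¬ ManyMultiple (q t) := by
  by_contra! hm
  refine not_forall_exists_lt_of_antitone (Φ := fun t => coincidences (q t))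
    (antitone_nat_of_succ_le fun t => ?_) fun t => ?_
  · rw [hq t (hm t)]
    exact hc.coincidences_step_le hσ
  · have hinf : ∀ t, ∃ s, t ≤ s ∧ ActiveMultiple (q s) (act s) := fun t => by
      by_contra! hno
      obtain ⟨i, j, -, -, hij, -, e, -⟩ := hm t
      have hstay : ∀ s, t ≤ s → q s i = q s j := fun s hs => by
        induction s, hs using Nat.le_induction with
        | base => exact e
        | succ s hs ih =>
          have hi : i ∉ act s := fun hi => hno s hs ⟨i, hi, j, hij.symm, ih.symm⟩
          have hj : j ∉ act s := fun hj => hno s hs ⟨j, hj, i, hij, ih⟩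
          rw [hq s (hm s), step, step, if_neg hi, if_neg hj, ih]
      obtain ⟨s, hs, hi⟩ := hfair i t
      exact hno s hs ⟨i, hi, j, hij.symm, (hstay s hs).symm⟩
    obtain ⟨s, hs, hB, e⟩ := hcoin hinf t
    refine ⟨s, hs, ?_⟩
    rw [hq s (hm s), e]
    exact hc.coincidences_step_lt hσ hB

theorem step_procSSAGP_of_manyMultiple (A : DetAlgorithm) (h : ManyMultiple p) :
    step (procSSAGP c A) F σ act coin p = step (procSP c) F σ act coin p := by
  funext i
  simp only [step, procSSAGP, two_le_card_multiple, if_pos h]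

theorem step_procSSAGP_of_not_manyMultiple (A : DetAlgorithm) (h : ¬ ManyMultiple p) :
    step (procSSAGP c A) F σ act coin p = step A.toProtocol F σ act coin p := by
  funext i
  simp only [step, procSSAGP, two_le_card_multiple, if_neg h, DetAlgorithm.toProtocol]

theorem GatheredAt.isPole (hn : 2 ≤ n) {x : Plane} (h : GatheredAt p x) : IsPole p x :=
  ⟨fun i _ _ _ => h i, Or.inl ⟨⟨0, by omega⟩, ⟨1, by omega⟩, by simp, h _, h _⟩⟩

theorem procSSAGP_selfStabilizing (hc : IsCellChoice c) (hn : 3 ≤ n) :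
    SelfStabilizingGathering n (procSSAGP c gatherAlg) := by
  intro F σ hσ p₀ Ω _ μ _ S
  filter_upwards [S.act_fair, S.ae_frequently_coin_eq (procSSAGP c gatherAlg) F σ p₀
    ActiveMultiple separatingCoin] with ω hfair hcoin
  refine ⟨?_, fun t x hx i => ?_⟩
  · obtain ⟨T, hT⟩ := hc.exists_not_manyMultiple hσ hfair
      (q := run (procSSAGP c gatherAlg) F σ p₀ (fun s => S.act s ω) (fun s => S.coin s ω))
      (coin := fun s => S.coin s ω)
      (fun t h => step_procSSAGP_of_manyMultiple gatherAlg h) hcoin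
    exact eventually_gatheredAt hn hσ hfair (coin := fun s => S.coin s ω)
      (fun t h => step_procSSAGP_of_not_manyMultiple gatherAlg h) hT
  · have hp := hx.isPole (by omega)
    rw [run, step_procSSAGP_of_not_manyMultiple gatherAlg hp.not_manyMultiple]
    exact hp.step_eq_of_eq hσ (hx i)

end Scatter

/-! ### Two robots -/

section Pair

variable {F : Fin 2 → Frame} {σ : Fin 2 → ℝ} {act : Finset (Fin 2)} {coin : Fin 2 → Fin 2}
  {p : Config 2}

theorem eq_or_eq_rev (i j : Fin 2) : j = i ∨ j = i.rev := by
  revert i j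
  decide

theorem toGlobal_otherPosition (F : Frame) (p : Config 2) (i : Fin 2) :
    F.toGlobal (p i) (otherPosition (view F p i)) = p i.rev := by
  unfold otherPosition
  split_ifs with h
  · obtain ⟨hx, h0⟩ := h.choose_spec
    obtain ⟨j, hj⟩ := (mem_occupied F p i).1 hx
    rw [← hj, F.toGlobal_toLocal]
    rcases eq_or_eq_rev i j with rfl | rfl
    · exact absurd (hj.symm.trans (F.toLocal_self _)) h0
    · rfl
  · rw [F.toGlobal_zero]
    by_contra hne
    exact h ⟨_, (mem_occupied F p i).2 ⟨i.rev, rfl⟩,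
      fun e => hne (F.toLocal_eq_zero.1 e).symm⟩

theorem step_procPair (hσ : ∀ i, 0 < σ i) (i : Fin 2) :
    step procPair F σ act coin p i =
      if i ∈ act ∧ coin i = 0 then moveToward (σ i) (p i) (p i.rev) else p i := by
  by_cases hi : i ∈ act <;> by_cases h0 : coin i = 0 <;>
    simp [step, procPair, hi, h0, toGlobal_otherPosition, Frame.toGlobal_zero,
      moveToward_self _ (hσ i).le]

theorem exists_step_procPair_eq (hσ : ∀ i, 0 < σ i) (i : Fin 2) : ∃ a : ℝ, 0 ≤ a ∧ a ≤ 1 ∧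
    step procPair F σ act coin p i = p i + a • (p i.rev - p i) := by
  rw [step_procPair hσ]
  split_ifs
  · obtain ⟨a, h0, h1, e⟩ := exists_moveToward_eq (hσ i) (p i) (p i.rev)
    exact ⟨a, h0.le, h1, e⟩
  · exact ⟨0, le_rfl, zero_le_one, by simp⟩

theorem GatheredAt.step_procPair (hσ : ∀ i, 0 < σ i) {x : Plane} (h : GatheredAt p x) :
    GatheredAt (step procPair F σ act coin p) x := fun i => by
  obtain ⟨a, -, -, e⟩ := exists_step_procPair_eq (F := F) (act := act) (coin := coin) hσ i
  rw [e, h, h, sub_self, smul_zero, add_zero]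

/-- The separation is multiplied by `1 - a - b`, which lies in $[-1, 1]$; the value $-1$ is a full
exchange of positions. -/
theorem dist_step_procPair_le (hσ : ∀ i, 0 < σ i) :
    dist (step procPair F σ act coin p 0) (step procPair F σ act coin p 1) ≤
      dist (p 0) (p 1) := by
  obtain ⟨a, ha0, ha1, ea⟩ := exists_step_procPair_eq (F := F) (act := act) (coin := coin)
    (p := p) hσ 0
  obtain ⟨b, hb0, hb1, eb⟩ := exists_step_procPair_eq (F := F) (act := act) (coin := coin)
    (p := p) hσ 1
  rw [show (Fin.rev 0 : Fin 2) = 1 from rfl] at ea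
  rw [show (Fin.rev 1 : Fin 2) = 0 from rfl] at eb
  have e : p 0 + a • (p 1 - p 0) - (p 1 + b • (p 0 - p 1)) = (1 - a - b) • (p 0 - p 1) := by
    module
  rw [ea, eb, dist_eq_norm, dist_eq_norm, e, norm_smul]
  refine mul_le_of_le_one_left (norm_nonneg _) ?_
  rw [Real.norm_eq_abs, abs_le]
  constructor <;> linarith

theorem dist_step_procPair_soleCoin (hσ : ∀ i, 0 < σ i) {i : Fin 2} (hi : i ∈ act) :
    dist (step procPair F σ act (soleCoin i) p 0) (step procPair F σ act (soleCoin i) p 1) =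
      max (dist (p 0) (p 1) - σ i) 0 := by
  have h1 : step procPair F σ act (soleCoin i) p i = moveToward (σ i) (p i) (p i.rev) := by
    rw [step_procPair hσ, if_pos ⟨hi, by simp [soleCoin]⟩]
  have hrev : i.rev ≠ i := by
    clear h1 hi
    revert i
    decide
  have h2 : step procPair F σ act (soleCoin i) p i.rev = p i.rev := by
    rw [step_procPair hσ, if_neg]
    simp [soleCoin, hrev]
  have h3 := dist_moveToward (hσ i) (p i) (p i.rev)
  fin_cases i
  · exact (congrArg₂ dist h1 h2).trans h3
  · rw [dist_comm, dist_comm (p 0)]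
    exact (congrArg₂ dist h1 h2).trans h3

theorem procPair_selfStabilizing : SelfStabilizingGathering 2 procPair := by
  intro F σ hσ p₀ Ω _ μ _ S
  -- The predictable event is trivial, since some robot is active at every step; the coins wanted
  -- let a single active robot move.
  filter_upwards [S.ae_frequently_coin_eq procPair F σ p₀ (fun _ _ => True)
    (fun _ act => if h : act.Nonempty then soleCoin h.choose else 0)] with ω hcoin
  set q := run procPair F σ p₀ (fun s => S.act s ω) (fun s => S.coin s ω) with hq
  have hclosed : ∀ t x, GatheredAt (q t) x → GatheredAt (q (t + 1)) x := fun t x h =>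
    h.step_procPair hσ
  refine ⟨?_, hclosed⟩
  suffices ∃ T, q T 0 = q T 1 by
    obtain ⟨T, hT⟩ := this
    refine ⟨T, q T 1, fun t ht => ?_⟩
    induction t, ht using Nat.le_induction with
    | base => exact Fin.forall_fin_two.2 ⟨hT, rfl⟩
    | succ t _ ih => exact hclosed t _ ih
  by_contra! hne
  -- The smaller bound is a unit of progress valid whichever robot moves.
  have hm : 0 < min (σ 0) (σ 1) := lt_min (hσ 0) (hσ 1)
  have hmle : ∀ i, min (σ 0) (σ 1) ≤ σ i :=
    Fin.forall_fin_two.2 ⟨min_le_left _ _, min_le_right _ _⟩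
  refine not_forall_exists_lt_of_antitone
    (Φ := fun t => ⌈dist (q t 0) (q t 1) / min (σ 0) (σ 1)⌉₊)
    (antitone_nat_of_succ_le fun t => ?_) fun t => ?_
  · exact Nat.ceil_mono (div_le_div_of_nonneg_right (dist_step_procPair_le hσ) hm.le)
  · obtain ⟨s, hs, -, e⟩ := hcoin (fun t => ⟨t, le_rfl, trivial⟩) t
    refine ⟨s, hs, lt_of_le_of_lt ?_ (ceil_max_sub_lt hm (dist_pos.2 (hne s)))⟩
    have hact := S.act_nonempty s ω
    rw [dif_pos hact] at e
    refine Nat.ceil_mono (div_le_div_of_nonneg_right ?_ hm.le)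
    change dist (step procPair F σ (S.act s ω) (S.coin s ω) (q s) 0)
      (step procPair F σ (S.act s ω) (S.coin s ω) (q s) 1) ≤ _
    rw [e, dist_step_procPair_soleCoin hσ hact.choose_spec]
    exact max_le_max_right 0 (by linarith [hmle hact.choose])

end Pair

/-! ### The protocol -/

/-- The protocol: the routine for two robots if two robots are at distinct positions, and
`SSA_GP` otherwise. -/
def gatherProtocol (c : View → Plane) : Protocol := fun v r =>
  if v.occupied.card = 2 ∧ v.multiple = ∅ then procPair v r else procSSAGP c gatherAlg v r

theorem card_occupied_of_injective {n : ℕ} (F : Frame) {p : Config n} (hp : Function.Injective p)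
    (i : Fin n) : (view F p i).occupied.card = n := by
  rw [view, Finset.card_image_of_injective _ fun a b h => hp (F.toLocal_inj.1 h),
    Finset.card_univ, Fintype.card_fin]

theorem gatherProtocol_sameBehaviour_procSSAGP (c : View → Plane) {n : ℕ} (hn : 3 ≤ n) :
    SameBehaviour n (gatherProtocol c) (procSSAGP c gatherAlg) := by
  intro F p i r
  refine if_neg ?_
  rintro ⟨h2, he⟩
  rw [card_occupied_of_injective F ((multiple_eq_empty F p i).1 he)] at h2
  omega

/-- Two robots at one point fall to the other branch, but there both routines stay put. -/
theorem gatherProtocol_sameBehaviour_procPair (c : View → Plane) :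
    SameBehaviour 2 (gatherProtocol c) procPair := by
  intro F p i r
  by_cases hp : Function.Injective p
  · exact if_pos ⟨card_occupied_of_injective F hp i, (multiple_eq_empty F p i).2 hp⟩
  · have h01 : p 0 = p 1 := by
      by_contra h
      refine hp fun a b hab => ?_
      fin_cases a <;> fin_cases b <;> simp_all
    have hg : GatheredAt p (p i) := by
      intro j
      fin_cases i <;> fin_cases j <;> simp [h01]
    have hpole := hg.isPole le_rfl
    have hA : gatherAlg (view F p i) = 0 := by
      rw [← F.toLocal_toGlobal (p i) (gatherAlg _), hpole.toGlobal_gatherAlg, ite_self,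
        F.toLocal_self]
    have hother : otherPosition (view F p i) = 0 := by
      rw [← F.toLocal_toGlobal (p i) (otherPosition _), toGlobal_otherPosition, hg i.rev,
        F.toLocal_self]
    rw [gatherProtocol, if_neg fun h => hp ((multiple_eq_empty F p i).1 h.2), procSSAGP,
      if_neg fun h => hpole.not_manyMultiple ((two_le_card_multiple F p i).1 h), hA, procPair,
      hother, ite_self]

theorem SameBehaviour.run_eq {n : ℕ} {P Q : Protocol} (h : SameBehaviour n P Q)
    (F : Fin n → Frame) (σ : Fin n → ℝ) (p₀ : Config n) (act : ℕ → Finset (Fin n))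
    (coin : ℕ → Fin n → Fin 2) : run P F σ p₀ act coin = run Q F σ p₀ act coin := by
  funext t
  induction t with
  | zero => rfl
  | succ t ih =>
    funext i
    simp only [run, step, ih, h (F i) _ i]

theorem SameBehaviour.selfStabilizingGathering {n : ℕ} {P Q : Protocol} (h : SameBehaviour n P Q)
    (hQ : SelfStabilizingGathering n Q) : SelfStabilizingGathering n P := by
  intro F σ hσ p₀ Ω _ μ _ S
  simp only [h.run_eq]
  exact hQ F σ hσ p₀ Ω μ S

end

end Robots

theorem theorem4 :
    ∃ P : Robots.Protocol,
      (∀ n : ℕ, 2 ≤ n → Robots.SelfStabilizingGathering n P) ∧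
      Robots.SameBehaviour 2 P Robots.procPair ∧
      ∃ (c : Robots.View → Robots.Plane) (A : Robots.DetAlgorithm),
        Robots.IsCellChoice c ∧
        (∀ n : ℕ, 3 ≤ n → Robots.DetGatheringFromDistinct n A) ∧
        (∀ n : ℕ, 3 ≤ n → Robots.SameBehaviour n P (Robots.procSSAGP c A)) := by
  obtain ⟨c, hc⟩ := Robots.exists_isCellChoice
  refine ⟨Robots.gatherProtocol c, fun n hn => ?_, Robots.gatherProtocol_sameBehaviour_procPair c,
    c, Robots.gatherAlg, hc, fun n hn => Robots.gatherAlg_detGatheringFromDistinct hn,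
    fun n hn => Robots.gatherProtocol_sameBehaviour_procSSAGP c hn⟩
  rcases hn.eq_or_lt with rfl | hn
  · exact (Robots.gatherProtocol_sameBehaviour_procPair c).selfStabilizingGathering
      Robots.procPair_selfStabilizing
  · exact (Robots.gatherProtocol_sameBehaviour_procSSAGP c hn).selfStabilizingGathering
      (Robots.procSSAGP_selfStabilizing hc hn)
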